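/- **Setting.** Let $2\le n\le d$ and $k\ge 0$. A parameter $\theta\in\mathbb R^d$ is drawn from a prior supported on $\{\|\theta\|_2\le\tau_\theta,\ \|\theta\|_0\le k\}$ (a fixed $\theta^*$ is the case of a point mass). Given $\theta$, the $n$ agents are i.i.d.: agent $i$ holds $D_i=(x_i,y_i)\in\mathbb R^d\times\mathbb R$ with $y_i=\langle\theta,x_i\rangle+\zeta_i$, $\mathbb E[\zeta_i\mid x_i]=0$, where the law of $x_i$ does not depend on $\theta$, $x_i$ is (zero-mean) sub-Gaussian with variance proxy $\sigma^2/d$ (i.e. $\mathbb E e^{t\langle x_i,u\rangle}\le e^{\sigma^2t^2/(2d)}$ for all unit $u$ and $t\in\mathbb R$) and $y_i$ is (zero-mean) sub-Gaussian with variance proxy $\sigma^2$; and a privacy cost coefficient $c_i\ge0$ drawn from a conditional law $p(c\mid D_i)$, independently of everything else given $D_i$, with $\inf_{D}\mathbb P(c\le\tau\mid D)\ge1-e^{-\lambda\tau}$ for some $\lambda>0$. **Estimator.** For data $(x_i,y_i)_{i\in S}$, $m=|S|$, let $\bar x_i=\Pi_r(x_i)$ (projection onto the Euclidean ball of radius $r$),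 $\tilde x_i,\tilde y_i$ the entrywise clippings of $x_i,y_i$ at levels $\tau_x,\tau_y$, $\dot\Sigma_{XX}=\frac1m\sum\bar x_i\bar x_i^T+N_1$ and $\dot\Sigma_{XY}=\frac1m\sum\tilde x_i\tilde y_i+N_2$, where $N_1$ is symmetric with independent $\mathcal N(0,\frac{32r^4\log(2.5/\delta)}{m^2\varepsilon^2})$ entries on and above the diagonal and $N_2$ has independent $\mathcal N(0,\frac{32\tau_x^2\tau_y^2\log(2.5/\delta)}{m^2\varepsilon^2})$ entries. Let $\ddot\Sigma_{XX}$ be $\dot\Sigma_{XX}$ with all entries of absolute value at most $\gamma\sqrt{\frac{\log d}{m}}+\frac{4r^2\sqrt{2\ln(1.25/\delta)}\sqrt{\log d}}{m\varepsilon}$ set to $0$. Put $\hat\theta^P=S_{\lambda_n}(\ddot\Sigma_{XX}^{-1}\dot\Sigma_{XY})$ (entrywise soft thresholding; the inverse is read as $0$ if the matrix is singular) and $\bar\theta^P=\Pi_{\tau_\theta}(\hat\theta^P)$. **Mechanism (Algorithm 2).** Agents report $\hat D_i=(x_i,\hat y_i)$ (only the response can be misreported). The agents are randomly partitioned into two groups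 (any law of the partition, independent of everything else); $\bar\theta^P$ is computed on all reports and on each group $\hat D^0,\hat D^1$ with independent noise, and agent $i$ in group $1-b$ is paid $$\pi_i=B_{a_1,a_2}\big(\langle\bar x_i,\bar\theta^P(\hat D^b)\rangle,\ \langle\bar x_i,\mathbb E_{\theta\sim p(\theta\mid\hat D_i)}[\theta]\rangle\big),\qquad B_{a_1,a_2}(p,q)=a_1-a_2(p-2pq+q^2).$$ The utility is $u_i=\pi_i-f_i$, where the privacy cost $f_i$ is that of a $(2\varepsilon,3\delta)$-jointly differentially private mechanism (the privacy level of Algorithm 2); the cost in an $(\varepsilon',\delta')$-jointly differentially private mechanism may depend on the agent's data and report and lies in $[0,\,c_i(1+\delta')\varepsilon'^3]$. **Equilibrium.** Let $p$ be the marginal law of $c_i$ and $\tau_{\alpha,\beta}=\max\{\tau^1_{\alpha,\beta},\tau^2_\alpha\}$, with $\tau^1_{\alpha,\beta}=\inf\{\tau>0:\mathbb P_{p^n}(\#\{i:c_i\le\tau\}\ge(1-\alpha)n)\ge1-\beta\}$ and $\tau^2_\alpha=\inf\{\tau>0:\inf_D\mathbb P(c\le\tau\mid D)\ge1-\alpha\}$.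 The symmetric threshold strategy $\sigma_{\tau_{\alpha,\beta}}$ reports $\hat y_i=y_i$ if $c_i\le\tau_{\alpha,\beta}$ and an arbitrary value (any measurable function of $(D_i,c_i)$) otherwise. It is an *$\eta$-approximate Bayesian Nash equilibrium at* $(D_i,c_i)_{i\le n}$ if for every $i$ and every report $y'$ that $\sigma_{\tau_{\alpha,\beta}}$ does not allow for $(D_i,c_i)$, the expected utility of agent $i$ given $(D_i,c_i)$, over $(D_{-i},c_{-i})\sim p(\cdot\mid D_i,c_i)$ and the randomness of the mechanism, when the others follow $\sigma_{\tau_{\alpha,\beta}}$, is at most $\eta$ larger with report $y'$ than under $\sigma_{\tau_{\alpha,\beta}}$. **Theorem.** Fix $\sigma,\tau_\theta>0$ and $0<c_1\le c_2$. There are constants $C,c>0$, depending only on these, such that for all $2\le n\le d$, all $k$, every model as above (any $\lambda>0$), all $\alpha,\beta\in(0,1)$, $0<\varepsilon\le1$, $0<\delta\le\frac12$, $a_1,a_2>0$, all $\tau_x,\tau_y,\lambda_n,\gamma>0$ and all $r$ with $c_1\sigma\sqrt{\log n}\le r\le c_2\sigma\sqrt{\log n}$, the following holds. With probability at least $$1-\beta-Cn^{-c}-nd^{-9/2}$$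 over $(D_i,c_i)_{i\le n}$, the symmetric threshold strategy $\sigma_{\tau_{\alpha,\beta}}$ is an $\eta$-approximate Bayesian Nash equilibrium of Algorithm 2 with $$\eta=C\Big(a_2r^4\log d\,\log\tfrac1\delta\Big(\frac{n\alpha^2k}{\varepsilon^2}+\frac1{n\varepsilon^2}\Big)+\tau_{\alpha,\beta}(1+\delta)\varepsilon^3\Big).$$ If moreover the privacy costs $f_i=f_i(c_i,\varepsilon,\delta)$ do not depend on the data and on the report, the same holds with $\eta=C\big(a_2r^4\log d\log\frac1\delta\big(\frac{n\alpha^2k}{\varepsilon^2}+\frac1{n\varepsilon^2}\big)+\tau_{\alpha,\beta}\delta\varepsilon^3\big)$. -/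

import Mathlib

open MeasureTheory ProbabilityTheory
open scoped NNReal ENNReal

namespace TruthfulRegression

/-- Feature space with the Euclidean norm. -/
abbrev Vec (d : ℕ) := EuclideanSpace ℝ (Fin d)

/-- A data point `D = (x, y)`: feature vector and response. -/
abbrev Datum (d : ℕ) := Vec d × ℝ

/-- The private information `(D, c)` of an agent: data point and privacy cost coefficient. -/
abbrev AgentType (d : ℕ) := Datum d × ℝ

instance (d n : ℕ) : StandardBorelSpace (Fin n → AgentType d) :=
  StandardBorelSpace.pi_countable

/-! ### The statistical model -/

/-- Product of `n` copies of a Markov kernel: given `a`, the `n` coordinates are i.i.d. with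
law `κ a`. -/
noncomputable def piKernel {A B : Type*} [MeasurableSpace A] [MeasurableSpace B] (n : ℕ)
    (κ : Kernel A B) [IsMarkovKernel κ] : Kernel A (Fin n → B) where
  toFun a := Measure.pi fun _ => κ a
  measurable' := by
    refine Measurable.measure_of_isPiSystem_of_isProbabilityMeasure
      generateFrom_pi.symm isPiSystem_pi ?_
    rintro s ⟨t, ht, rfl⟩
    simp only [Measure.pi_pi]
    exact Finset.measurable_prod _ fun i _ => κ.measurable_coe (ht i (Set.mem_univ i))

instance {A B : Type*} [MeasurableSpace A] [MeasurableSpace B] (n : ℕ)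
    (κ : Kernel A B) [IsMarkovKernel κ] : IsMarkovKernel (piKernel n κ) :=
  ⟨fun a => by
    change IsProbabilityMeasure (Measure.pi fun _ => κ a)
    infer_instance⟩

/-- A Bayesian regression model with privacy costs: the prior `p(θ)`, the law `p(x, y | θ)` of one
data point, and the law `p(c | x, y)` of the privacy cost coefficient of the owner of `(x, y)`. -/
structure RegressionModel (d : ℕ) where
  prior : Measure (Vec d)
  data : Kernel (Vec d) (Datum d)
  cost : Kernel (Datum d) ℝ
  [prior_prob : IsProbabilityMeasure prior]
  [data_markov : IsMarkovKernel data]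
  [cost_markov : IsMarkovKernel cost]

attribute [instance] RegressionModel.prior_prob RegressionModel.data_markov
  RegressionModel.cost_markov

namespace RegressionModel

variable {d : ℕ} (M : RegressionModel d)

/-- The law of `(D_i, c_i)` given `θ`. -/
noncomputable def agentLaw : Kernel (Vec d) (AgentType d) :=
  M.data ⊗ₖ Kernel.prodMkLeft (Vec d) M.cost

noncomputable instance : IsMarkovKernel M.agentLaw := by
  unfold agentLaw; infer_instance

/-- The joint law of `(D_i, c_i)`, `i < n`: draw `θ` from the prior, then the agents i.i.d.
given `θ`. In particular, given `D_i`, the coefficient `c_i` is independent of the data and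
the coefficients of the other agents. -/
noncomputable def jointLaw (n : ℕ) : Measure (Fin n → AgentType d) :=
  M.prior.bind (piKernel n M.agentLaw)

noncomputable instance (n : ℕ) : IsProbabilityMeasure (M.jointLaw n) := by
  unfold jointLaw; infer_instance

/-- The (marginal) law `p(c)` of a privacy cost coefficient. -/
noncomputable def costLaw : Measure ℝ := (M.prior.bind M.agentLaw).map Prod.snd

/-- The mean `E_{θ ∼ p(θ | D)}[θ]` of the posterior distribution. -/
noncomputable def posteriorMean (D : Datum d) : Vec d :=
  ∫ θ, θ ∂(posterior M.data M.prior D)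

/-- The law `p(D_{-i}, c_{-i} | D_i, c_i)`, as a regular conditional law of the whole profile given
the type of agent `i`; coordinate `i` of the profile is not used later. -/
noncomputable def beliefs {n : ℕ} (i : Fin n) : Kernel (AgentType d) (Fin n → AgentType d) :=
  condDistrib (fun t => t) (fun t => t i) (M.jointLaw n)

/-- The assumptions on the model: a sparse linear model with bounded parameter, whose covariates
are sub-Gaussian with variance proxy `σ² / d` and whose responses are sub-Gaussian with variance
proxy `σ²` (sub-Gaussianity as in `HasSubgaussianMGF` entails mean zero), and nonnegative
privacy cost coefficients with an exponentially decaying tail of rate `rate`. -/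
structure Satisfies (σ : ℝ≥0) (τθ : ℝ) (k : ℕ) (rate : ℝ) : Prop where
  norm_le : ∀ᵐ θ ∂M.prior, ‖θ‖ ≤ τθ
  sparse : ∀ᵐ θ ∂M.prior, (Finset.univ.filter fun j => θ j ≠ 0).card ≤ k
  /-- The law of the features does not depend on `θ`, and it is sub-Gaussian. -/
  covariates : ∃ PX : Measure (Vec d), (∀ᵐ θ ∂M.prior, (M.data θ).map Prod.fst = PX) ∧
    ∀ u : Vec d, ‖u‖ = 1 → HasSubgaussianMGF (fun x => inner ℝ x u) (σ ^ 2 / d) PX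
  /-- `y = ⟨θ, x⟩ + ζ` with `E[ζ | x] = 0`. -/
  linear : ∀ᵐ θ ∂M.prior,
    (M.data θ)[fun D => D.2 - inner ℝ θ D.1 | MeasurableSpace.comap Prod.fst inferInstance]
      =ᵐ[M.data θ] 0
  response : ∀ᵐ θ ∂M.prior, HasSubgaussianMGF (fun D => D.2) (σ ^ 2) (M.data θ)
  cost_nonneg : ∀ D, ∀ᵐ c ∂M.cost D, 0 ≤ c
  cost_tail : ∀ D τ, 1 - Real.exp (-(rate * τ)) ≤ (M.cost D).real (Set.Iic τ)

/-- `τ¹_{α,β}`: with probability `1 - β`, a `1 - α` fraction of `n` i.i.d. cost coefficients is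
at most this threshold. -/
noncomputable def thresholdCount (n : ℕ) (α β : ℝ) : ℝ :=
  sInf {τ : ℝ | 0 < τ ∧ 1 - β ≤ (Measure.pi fun _ : Fin n => M.costLaw).real
    {c | (1 - α) * n ≤ ((Finset.univ.filter fun i => c i ≤ τ).card : ℝ)}}

/-- `τ²_α`: whatever the data point, its owner has a cost coefficient at most this threshold with
probability `1 - α`. -/
noncomputable def thresholdBelief (α : ℝ) : ℝ :=
  sInf {τ : ℝ | 0 < τ ∧ 1 - α ≤ ⨅ D : Datum d, (M.cost D).real (Set.Iic τ)}

/-- The threshold `τ_{α,β}`. -/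
noncomputable def threshold (n : ℕ) (α β : ℝ) : ℝ :=
  max (M.thresholdCount n α β) (M.thresholdBelief α)

end RegressionModel

/-! ### The private estimator -/

/-- Parameters of the estimator: `r`, `τx`, `τy` are clipping levels, `lam` is the soft threshold,
`γ` the constant in the hard threshold, `τθ` the radius of the final projection and `ε`, `δ` are
the privacy parameters. -/
structure Params where
  r : ℝ
  τx : ℝ
  τy : ℝ
  lam : ℝ
  γ : ℝ
  τθ : ℝ
  ε : ℝ
  δ : ℝ

/-- Euclidean projection onto the closed ball of radius `ρ` around the origin. -/
noncomputable def clipBall {d : ℕ} (ρ : ℝ) (v : Vec d) : Vec d := min 1 (ρ / ‖v‖) • v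

/-- Scalar clipping `sgn(t) min {|t|, τ}`. -/
noncomputable def clip (τ t : ℝ) : ℝ := Real.sign t * min |t| τ

/-- Entrywise hard thresholding. -/
noncomputable def hardThreshold {d : ℕ} (T : ℝ) (A : Matrix (Fin d) (Fin d) ℝ) :
    Matrix (Fin d) (Fin d) ℝ :=
  Matrix.of fun i j => if T < |A i j| then A i j else 0

/-- Entrywise soft thresholding. -/
noncomputable def softThreshold {d : ℕ} (l : ℝ) (u : Fin d → ℝ) : Fin d → ℝ :=
  fun j => Real.sign (u j) * max (|u j| - l) 0

/-- Standard normal variables from which the noise of one run of the estimator is built. -/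
abbrev Noise (d : ℕ) := (Fin d × Fin d → ℝ) × (Fin d → ℝ)

/-- The law of `Noise d`: all entries are independent standard normal variables. -/
noncomputable def noiseLaw (d : ℕ) : Measure (Noise d) :=
  (Measure.pi fun _ => gaussianReal 0 1).prod (Measure.pi fun _ => gaussianReal 0 1)

section Estimator

variable {d n : ℕ} (P : Params) (S : Finset (Fin n)) (z : Fin n → Datum d) (g : Noise d)

/-- Noisy covariance matrix of the clipped features of the agents in `S`. The noise is a symmetric
matrix whose entries on and above the diagonal are independent
`N(0, 32 r⁴ log(2.5/δ) / (|S|² ε²))` variables. -/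
noncomputable def noisyCovXX : Matrix (Fin d) (Fin d) ℝ :=
  Matrix.of fun i j =>
    (∑ l ∈ S, clipBall P.r (z l).1 i * clipBall P.r (z l).1 j) / (S.card : ℝ) +
      √(32 * P.r ^ 4 * Real.log (2.5 / P.δ) / ((S.card : ℝ) ^ 2 * P.ε ^ 2)) *
        g.1 (min i j, max i j)

/-- Noisy covariance vector of clipped features and clipped responses of the agents in `S`, with
independent `N(0, 32 τx² τy² log(2.5/δ) / (|S|² ε²))` noise. -/
noncomputable def noisyCovXY : Fin d → ℝ :=
  fun j =>
    (∑ l ∈ S, clip P.τx ((z l).1 j) * clip P.τy (z l).2) / (S.card : ℝ) +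
      √(32 * P.τx ^ 2 * P.τy ^ 2 * Real.log (2.5 / P.δ) / ((S.card : ℝ) ^ 2 * P.ε ^ 2)) * g.2 j

/-- The level of the hard threshold for `m` data points in dimension `d`. -/
noncomputable def thres (m d : ℕ) : ℝ :=
  P.γ * √(Real.log d / m) +
    4 * P.r ^ 2 * √(2 * Real.log (1.25 / P.δ)) * √(Real.log d) / (m * P.ε)

/-- The private estimator before projection, run on the data of the agents in `S`. The matrix
inverse is `0` on singular matrices, where the procedure itself specifies no output. -/
noncomputable def privateEstimator : Vec d :=
  WithLp.toLp 2 (softThreshold P.lam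
    (Matrix.mulVec (hardThreshold (thres P S.card d) (noisyCovXX P S z g))⁻¹
      (noisyCovXY P S z g)))

/-- The private estimator after projection onto the ball of radius `τθ`. -/
noncomputable def projectedEstimator : Vec d := clipBall P.τθ (privateEstimator P S z g)

end Estimator

/-! ### The mechanism -/

/-- The rescaled Brier score. -/
def brier (a₁ a₂ p q : ℝ) : ℝ := a₁ - a₂ * (p - 2 * p * q + q ^ 2)

/-- Internal randomness of the mechanism: the partition of the agents into two groups, the noise
for the estimator on all reports and the noise for the estimators on the two groups. -/
abbrev Coins (d n : ℕ) := (Fin n → Bool) × (Noise d × (Bool → Noise d))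

/-- The partition has law `ρ` and is independent of the noise. -/
noncomputable def coinLaw {n : ℕ} (d : ℕ) (ρ : Measure (Fin n → Bool)) : Measure (Coins d n) :=
  ρ.prod ((noiseLaw d).prod (Measure.pi fun _ => noiseLaw d))

/-- Output of the mechanism: the estimators on all reports and on the two groups, and the
payments. -/
structure Output (d n : ℕ) where
  full : Vec d
  group : Bool → Vec d
  payment : Fin n → ℝ

/-- The mechanism, as a function of the reported data `z` and of its internal randomness `w`.
An agent is paid according to the estimator computed from the other group and the posterior mean of
`θ` given her own report. -/
noncomputable def mechanism {d n : ℕ} (M : RegressionModel d) (P : Params) (a₁ a₂ : ℝ)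
    (z : Fin n → Datum d) (w : Coins d n) : Output d n :=
  let group : Bool → Vec d := fun b =>
    projectedEstimator P (Finset.univ.filter fun j => w.1 j = b) z (w.2.2 b)
  { full := projectedEstimator P Finset.univ z w.2.1
    group := group
    payment := fun i =>
      brier a₁ a₂ (inner ℝ (clipBall P.r (z i).1) (group (!w.1 i)))
        (inner ℝ (clipBall P.r (z i).1) (M.posteriorMean (z i))) }

/-! ### The game -/

/-- A pure reporting strategy: the reported response as a function of `(D, c)`. -/
abbrev Strategy (d : ℕ) := AgentType d → ℝ

/-- The reports that the threshold strategy with threshold `τ` allows for the type `(D, c)`: the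
true response if `c ≤ τ`, any response otherwise. -/
def thresholdReports {d : ℕ} (τ : ℝ) (t : AgentType d) : Set ℝ :=
  {y | t.2 ≤ τ → y = t.1.2}

/-- Privacy costs: `f i D y c ε δ` is the cost to agent `i` with data `D` and coefficient `c` of
reporting the response `y` to an `(ε, δ)`-jointly differentially private mechanism. -/
abbrev PrivacyCost (d n : ℕ) := Fin n → Datum d → ℝ → ℝ → ℝ → ℝ → ℝ

/-- The costs are nonnegative and at most `c (1 + δ) ε³`. -/
def PrivacyCost.Bounded {d n : ℕ} (f : PrivacyCost d n) : Prop :=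
  ∀ i D y c ε δ, 0 ≤ c → 0 < ε → 0 < δ →
    0 ≤ f i D y c ε δ ∧ f i D y c ε δ ≤ c * (1 + δ) * ε ^ 3

/-- The costs `f_i(c, ε, δ)` do not depend on the data and on the report. -/
def PrivacyCost.ReportIndependent {d n : ℕ} (f : PrivacyCost d n) : Prop :=
  ∀ i D D' y y' c ε δ, f i D y c ε δ = f i D' y' c ε δ

section Game

variable {d n : ℕ} (M : RegressionModel d) (P : Params) (a₁ a₂ : ℝ) (ρ : Measure (Fin n → Bool))
  (f : PrivacyCost d n) (s : Fin n → Strategy d)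

/-- The reported data when the agents have types `t'` and use the strategies `s`, except
for agent `i`, whose type is `t` and who reports the response `y`. -/
def reports (i : Fin n) (t : AgentType d) (y : ℝ) (t' : Fin n → AgentType d) : Fin n → Datum d :=
  Function.update (fun j => ((t' j).1.1, s j (t' j))) i (t.1.1, y)

/-- Expected utility `E[u_i | D_i, c_i]` of agent `i` with type `t = (D_i, c_i)` who reports `y`
while the others use `s`. The utility is payment minus privacy cost; the mechanism is
`(2ε, 3δ)`-jointly differentially private, so the cost is evaluated there. -/
noncomputable def interimUtility (i : Fin n) (t : AgentType d) (y : ℝ) : ℝ :=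
  ∫ t', ∫ w,
    ((mechanism M P a₁ a₂ (reports s i t y t') w).payment i
      - f i t.1 y t.2 (2 * P.ε) (3 * P.δ)) ∂(coinLaw d ρ) ∂(M.beliefs i t)

/-- The equilibrium condition at the realized types `t`, for a strategy given by the sets
`allowed t_i` of reports and the selection `s` from them: no agent gains more than `η`
in expected utility, given her own type, by a report that the strategy does not allow. -/
def IsApproxBNEAt (allowed : AgentType d → Set ℝ) (η : ℝ) (t : Fin n → AgentType d) : Prop :=
  ∀ i, ∀ y, y ∉ allowed (t i) →
    interimUtility M P a₁ a₂ ρ f s i (t i) y - η ≤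
      interimUtility M P a₁ a₂ ρ f s i (t i) (s i (t i))

end Game

/-- The part `a₂ r⁴ log d log(1/δ) (n α² k / ε² + 1 / (n ε²))` of the equilibrium gap. -/
noncomputable def paymentGap (P : Params) (a₂ α : ℝ) (n d k : ℕ) : ℝ :=
  a₂ * P.r ^ 4 * Real.log d * Real.log (1 / P.δ) *
    (n * α ^ 2 * k / P.ε ^ 2 + 1 / (n * P.ε ^ 2))

end TruthfulRegression

open TruthfulRegression

namespace TruthfulRegression

/-! ### General probability -/

/-! Completing the square in the Brier score shows that, against an expected peer prediction `p`,
moving the report's prediction from `q` to `q'` gains `a₂ ((q - p)² - (q' - p)²) ≤ a₂ (q - p)²`. The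
proof does not compare the estimator with the posterior mean; it shows that `p` and `q` are each of
order `√(log d / d)`.

Both are conditional means, given the agent's type, of `⟨x_i, v⟩` with `‖v‖ ≤ τθ`: `v` is the
projected estimator of the other group for `p` and the parameter itself for `q`. Given `θ`, the
feature `x_i` is independent of `v`, so `⟨x_i, v⟩` is sub-Gaussian with proxy `σ² τθ² / d`. Jensen's
inequality transfers the exponential moments to the conditional mean
(`measure_lt_abs_integral_le_exp`), which yields `measure_posteriorMean_le` and
`measure_peerPrediction_le`. A union bound over the agents costs `n d ^ (-9/2)`.

The resulting gain, of order `a₂ log d / d`, fits under the summand `1 / (n ε²)` of the gap because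
`n ≤ d` and `ε ≤ 1` (`predictionError_le_paymentGap`). Only agents below the cost threshold can
deviate, so the privacy costs change by at most a multiple of `τ (1 + δ) ε³`, and not at all if they
ignore data and report. -/

/-- Chernoff bound for a conditional mean: if the exponential moments of `F` under `μ ⊗ κ` are
sub-Gaussian, then so are the upper tails of `a ↦ ∫ F a b ∂κ a`. -/
theorem measure_le_integral_le_exp {A B : Type*} [MeasurableSpace A] [MeasurableSpace B]
    (μ : Measure A) (κ : Kernel A B) [IsMarkovKernel κ] {F : A → B → ℝ}
    (hF : Measurable (Function.uncurry F))
    (hbdd : ∀ᵐ a ∂μ, ∃ K, ∀ᵐ b ∂κ a, |F a b| ≤ K) {v : ℝ} (hv : 0 < v)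
    (hmgf : ∀ l : ℝ, ∫⁻ a, ∫⁻ b, ENNReal.ofReal (Real.exp (l * F a b)) ∂κ a ∂μ ≤
      ENNReal.ofReal (Real.exp (v * l ^ 2 / 2))) {s : ℝ} (hs : 0 ≤ s) :
    μ {a | s ≤ ∫ b, F a b ∂κ a} ≤ ENNReal.ofReal (Real.exp (-(s ^ 2 / (2 * v)))) := by
  -- The minimiser of the Chernoff exponent `v l² / 2 - l s`.
  set l := s / v with hl
  have hl0 : 0 ≤ l := by positivity
  have hmeas : Measurable fun a => ∫⁻ b, ENNReal.ofReal (Real.exp (l * F a b)) ∂κ a :=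
    Measurable.lintegral_kernel_prod_right (by fun_prop)
  have hexp : ENNReal.ofReal (Real.exp (l * s)) ≠ 0 := by
    simpa using Real.exp_pos _
  calc μ {a | s ≤ ∫ b, F a b ∂κ a}
      ≤ μ {a | ENNReal.ofReal (Real.exp (l * s)) ≤
          ∫⁻ b, ENNReal.ofReal (Real.exp (l * F a b)) ∂κ a} := by
        refine measure_mono_ae ?_
        filter_upwards [hbdd] with a ha hsa
        obtain ⟨K, hK⟩ := ha
        change s ≤ ∫ b, F a b ∂κ a at hsa
        change ENNReal.ofReal (Real.exp (l * s)) ≤ _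
        have hFa : Measurable (F a) := hF.comp measurable_prodMk_left
        have hint : Integrable (F a) (κ a) :=
          Integrable.of_bound hFa.aestronglyMeasurable K (by simpa using hK)
        have hint' : Integrable (fun b => Real.exp (l * F a b)) (κ a) := by
          refine Integrable.of_bound (by fun_prop) (Real.exp (l * K)) ?_
          filter_upwards [hK] with b hb
          rw [Real.norm_eq_abs, Real.abs_exp]
          exact Real.exp_le_exp.2 (mul_le_mul_of_nonneg_left ((le_abs_self _).trans hb) hl0)
        have hJ : Real.exp (∫ b, l * F a b ∂κ a) ≤ ∫ b, Real.exp (l * F a b) ∂κ a :=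
          convexOn_exp.map_integral_le Real.continuous_exp.continuousOn isClosed_univ
            (by simp) (hint.const_mul l) hint'
        rw [integral_const_mul] at hJ
        rw [← ofReal_integral_eq_lintegral_ofReal hint' (.of_forall fun b => (Real.exp_pos _).le)]
        refine ENNReal.ofReal_le_ofReal (le_trans ?_ hJ)
        exact Real.exp_le_exp.2 (mul_le_mul_of_nonneg_left hsa hl0)
    _ ≤ (∫⁻ a, ∫⁻ b, ENNReal.ofReal (Real.exp (l * F a b)) ∂κ a ∂μ) /
          ENNReal.ofReal (Real.exp (l * s)) :=
        meas_ge_le_lintegral_div hmeas.aemeasurable hexp ENNReal.ofReal_ne_top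
    _ ≤ ENNReal.ofReal (Real.exp (v * l ^ 2 / 2)) / ENNReal.ofReal (Real.exp (l * s)) := by
        gcongr
        exact hmgf l
    _ = ENNReal.ofReal (Real.exp (-(s ^ 2 / (2 * v)))) := by
        rw [← ENNReal.ofReal_div_of_pos (Real.exp_pos _), ← Real.exp_sub]
        congr 2
        rw [hl]
        field_simp
        ring

/-- Two-sided version of `measure_le_integral_le_exp`. -/
theorem measure_lt_abs_integral_le_exp {A B : Type*} [MeasurableSpace A] [MeasurableSpace B]
    (μ : Measure A) (κ : Kernel A B) [IsMarkovKernel κ] {F : A → B → ℝ}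
    (hF : Measurable (Function.uncurry F))
    (hbdd : ∀ᵐ a ∂μ, ∃ K, ∀ᵐ b ∂κ a, |F a b| ≤ K) {v : ℝ} (hv : 0 < v)
    (hmgf : ∀ l : ℝ, ∫⁻ a, ∫⁻ b, ENNReal.ofReal (Real.exp (l * F a b)) ∂κ a ∂μ ≤
      ENNReal.ofReal (Real.exp (v * l ^ 2 / 2))) {s : ℝ} (hs : 0 ≤ s) :
    μ {a | s < |∫ b, F a b ∂κ a|} ≤ 2 * ENNReal.ofReal (Real.exp (-(s ^ 2 / (2 * v)))) := by
  have h₁ := measure_le_integral_le_exp μ κ hF hbdd hv hmgf hs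
  have h₂ := measure_le_integral_le_exp μ κ (F := fun a b => -F a b) hF.neg
    (by simpa using hbdd) hv (fun l => by simpa using hmgf (-l)) hs
  rw [two_mul]
  refine le_trans ((measure_mono ?_).trans (measure_union_le _ _)) (add_le_add h₁ h₂)
  intro a ha
  rcases lt_abs.1 (show s < |∫ b, F a b ∂κ a| from ha) with h | h
  · exact Or.inl h.le
  · exact Or.inr (by simpa [integral_neg] using h.le)

/-- A bound on the integral of `f` over one coordinate bounds its integral over a product of
probability spaces. -/
theorem lintegral_pi_le_of_forall_update {ι : Type*} [Fintype ι] [DecidableEq ι] {X : ι → Type*}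
    [∀ i, MeasurableSpace (X i)] (μ : ∀ i, Measure (X i)) [∀ i, IsProbabilityMeasure (μ i)]
    {f : (∀ i, X i) → ℝ≥0∞} (hf : Measurable f) (i : ι) {K : ℝ≥0∞}
    (h : ∀ x, ∫⁻ y, f (Function.update x i y) ∂μ i ≤ K) :
    ∫⁻ x, f x ∂Measure.pi μ ≤ K := by
  have x₀ : ∀ j, X j := fun j => (nonempty_of_isProbabilityMeasure (μ j)).some
  -- Coordinate `i` is integrated innermost, with the others frozen; what remains is a constant
  -- integrated against probability measures. The base point `x₀` is immaterial.
  rw [lintegral_eq_lmarginal_univ x₀, lmarginal_erase' f hf (Finset.mem_univ i)]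
  refine (lmarginal_mono h x₀).trans ?_
  simp [lmarginal]

/-- Exponential moments of `⟨x, v⟩`, `‖v‖ ≤ τ`, from sub-Gaussianity in unit directions. -/
theorem lintegral_exp_inner_le {d : ℕ} {PX : Measure (Vec d)} [IsProbabilityMeasure PX] {c : ℝ≥0}
    (h : ∀ u : Vec d, ‖u‖ = 1 → HasSubgaussianMGF (fun x => inner ℝ x u) c PX) {τ : ℝ}
    {v : Vec d} (hv : ‖v‖ ≤ τ) (l : ℝ) :
    ∫⁻ x, ENNReal.ofReal (Real.exp (l * inner ℝ x v)) ∂PX ≤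
      ENNReal.ofReal (Real.exp (c * τ ^ 2 * l ^ 2 / 2)) := by
  rcases eq_or_ne v 0 with rfl | hv0
  · simp only [inner_zero_right, mul_zero, Real.exp_zero, ENNReal.ofReal_one, lintegral_const,
      measure_univ, mul_one]
    rw [← ENNReal.ofReal_one]
    exact ENNReal.ofReal_le_ofReal (Real.one_le_exp (by positivity))
  · have hn : 0 < ‖v‖ := norm_pos_iff.2 hv0
    have hu := h (‖v‖⁻¹ • v) (by rw [norm_smul, norm_inv, norm_norm, inv_mul_cancel₀ hn.ne'])
    have heq : ∀ x : Vec d, l * inner ℝ x v = (l * ‖v‖) * inner ℝ x (‖v‖⁻¹ • v) := by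
      intro x
      rw [inner_smul_right]
      field_simp
    simp_rw [heq]
    rw [← ofReal_integral_eq_lintegral_ofReal (hu.integrable_exp_mul _)
      (.of_forall fun b => (Real.exp_pos _).le)]
    refine ENNReal.ofReal_le_ofReal ((hu.mgf_le (l * ‖v‖)).trans (Real.exp_le_exp.2 ?_))
    have : ‖v‖ ^ 2 ≤ τ ^ 2 := by gcongr
    have : c * l ^ 2 * ‖v‖ ^ 2 ≤ c * l ^ 2 * τ ^ 2 := by gcongr
    nlinarith

/-! ### The estimator -/

theorem norm_clipBall_le {d : ℕ} {ρ : ℝ} (hρ : 0 ≤ ρ) (v : Vec d) : ‖clipBall ρ v‖ ≤ ρ := by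
  rw [clipBall, norm_smul, Real.norm_of_nonneg (by positivity)]
  rcases eq_or_ne v 0 with rfl | hv
  · simpa using hρ
  · calc min 1 (ρ / ‖v‖) * ‖v‖ ≤ ρ / ‖v‖ * ‖v‖ := by gcongr; exact min_le_right _ _
      _ = ρ := div_mul_cancel₀ _ (norm_ne_zero_iff.2 hv)

theorem measurable_clipBall {d : ℕ} (ρ : ℝ) : Measurable (clipBall (d := d) ρ) := by
  unfold clipBall
  fun_prop

theorem measurable_sign : Measurable Real.sign :=
  Measurable.ite measurableSet_Iio measurable_const
    (Measurable.ite measurableSet_Ioi measurable_const measurable_const)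

theorem measurable_clip (τ : ℝ) : Measurable (clip τ) :=
  measurable_sign.mul (by fun_prop)

theorem measurable_softThreshold_apply {Ω : Type*} [MeasurableSpace Ω] {d : ℕ} (l : ℝ)
    {u : Ω → Fin d → ℝ} (hu : ∀ j, Measurable fun ω => u ω j) (j : Fin d) :
    Measurable fun ω => softThreshold l (u ω) j :=
  (measurable_sign.comp (hu j)).mul (((hu j).abs.sub_const l).max measurable_const)

section MatrixMeasurability

variable {Ω : Type*} [MeasurableSpace Ω] {d : ℕ} {A : Ω → Matrix (Fin d) (Fin d) ℝ}

theorem measurable_det_of_apply (hA : ∀ i j, Measurable fun ω => A ω i j) :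
    Measurable fun ω => (A ω).det := by
  simp only [Matrix.det_apply]
  fun_prop

/-- By Cramer's rule the entries are quotients of determinants; the convention `0⁻¹ = 0` covers
singular matrices. -/
theorem measurable_inv_apply_of_apply (hA : ∀ i j, Measurable fun ω => A ω i j) (i j : Fin d) :
    Measurable fun ω => (A ω)⁻¹ i j := by
  simp only [Matrix.inv_def, Matrix.smul_apply, smul_eq_mul, Ring.inverse_eq_inv',
    Matrix.adjugate_apply]
  refine (measurable_det_of_apply hA).inv.mul (measurable_det_of_apply fun i' j' => ?_)
  by_cases h : i' = j
  · subst h; simp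
  · simpa [Matrix.updateRow_ne h] using hA i' j'

end MatrixMeasurability

section Estimator

variable {d n : ℕ} (P : Params) (S : Finset (Fin n))

theorem measurable_noisyCovXX_apply (i j : Fin d) :
    Measurable fun p : (Fin n → Datum d) × Noise d => noisyCovXX P S p.1 p.2 i j := by
  have hc : ∀ (l : Fin n) (i : Fin d), Measurable fun p : (Fin n → Datum d) × Noise d =>
      clipBall P.r (p.1 l).1 i := fun l i =>
    (measurable_pi_iff.1 (PiLp.continuous_ofLp 2 _).measurable i).comp
      ((measurable_clipBall _).comp (by fun_prop))
  simp only [noisyCovXX, Matrix.of_apply]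
  refine ((Finset.measurable_sum _ fun l _ => (hc l i).mul (hc l j)).div_const _).add ?_
  exact Measurable.const_mul (by fun_prop) _

theorem measurable_noisyCovXY_apply (j : Fin d) :
    Measurable fun p : (Fin n → Datum d) × Noise d => noisyCovXY P S p.1 p.2 j := by
  simp only [noisyCovXY]
  refine ((Finset.measurable_sum _ fun l _ => Measurable.mul ?_ ?_).div_const _).add ?_
  · exact (measurable_clip _).comp (by fun_prop)
  · exact (measurable_clip _).comp (by fun_prop)
  · exact Measurable.const_mul (by fun_prop) _

theorem measurable_privateEstimator :
    Measurable fun p : (Fin n → Datum d) × Noise d => privateEstimator P S p.1 p.2 := by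
  have hH : ∀ i j, Measurable fun p : (Fin n → Datum d) × Noise d =>
      hardThreshold (thres P S.card d) (noisyCovXX P S p.1 p.2) i j := by
    intro i j
    have hXX := measurable_noisyCovXX_apply P S (n := n) i j
    simp only [hardThreshold, Matrix.of_apply]
    exact Measurable.ite (measurableSet_lt measurable_const hXX.abs) hXX measurable_const
  refine (PiLp.continuous_toLp 2 _).measurable.comp (measurable_pi_lambda _ fun j => ?_)
  refine measurable_softThreshold_apply _ (fun i => ?_) j
  simp only [Matrix.mulVec, dotProduct]
  exact Finset.measurable_sum _ fun l _ =>
    (measurable_inv_apply_of_apply hH i l).mul (measurable_noisyCovXY_apply P S l)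

theorem measurable_projectedEstimator :
    Measurable fun p : (Fin n → Datum d) × Noise d => projectedEstimator P S p.1 p.2 :=
  (measurable_clipBall _).comp (measurable_privateEstimator P S)

-- This is what makes the payment rule work: an agent cannot influence the estimator of the other
-- group.
variable {S} in
theorem projectedEstimator_congr {z z' : Fin n → Datum d} (h : ∀ l ∈ S, z l = z' l)
    (g : Noise d) : projectedEstimator P S z g = projectedEstimator P S z' g := by
  have h₁ : noisyCovXX P S z g = noisyCovXX P S z' g := by
    unfold noisyCovXX
    congr! 7 with i j l hl <;> rw [h l hl]
  have h₂ : noisyCovXY P S z g = noisyCovXY P S z' g := by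
    unfold noisyCovXY
    congr! 5 with j l hl <;> rw [h l hl]
  rw [projectedEstimator, projectedEstimator, privateEstimator, privateEstimator, h₁, h₂]

end Estimator

/-! ### Payments and utilities -/

instance (d : ℕ) : IsProbabilityMeasure (noiseLaw d) := by
  unfold noiseLaw; infer_instance

instance {d n : ℕ} (ρ : Measure (Fin n → Bool)) [IsProbabilityMeasure ρ] :
    IsProbabilityMeasure (coinLaw d ρ) := by
  unfold coinLaw; infer_instance

instance {d n : ℕ} (M : RegressionModel d) (i : Fin n) : IsMarkovKernel (M.beliefs i) := by
  unfold RegressionModel.beliefs; infer_instance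

section Payments

variable {d n : ℕ} (M : RegressionModel d) (P : Params) (a₁ a₂ : ℝ) (ρ : Measure (Fin n → Bool))
  (f : PrivacyCost d n) (s : Fin n → Strategy d) (i : Fin n)

/-- The estimator which determines the payment of agent `i`, computed on the group that does not
contain `i`, when the agents have types `t'` and use the strategies `s`. -/
noncomputable def peerEstimate (t' : Fin n → AgentType d) (w : Coins d n) : Vec d :=
  projectedEstimator P (Finset.univ.filter fun j => w.1 j = !w.1 i)
    (fun j => ((t' j).1.1, s j (t' j))) (w.2.2 (!w.1 i))

theorem norm_peerEstimate_le (hτ : 0 ≤ P.τθ) (t' : Fin n → AgentType d) (w : Coins d n) :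
    ‖peerEstimate P s i t' w‖ ≤ P.τθ :=
  norm_clipBall_le hτ _

/-- The peer estimate does not depend on the type of agent `i`. -/
theorem peerEstimate_update (t' : Fin n → AgentType d) (t : AgentType d) (w : Coins d n) :
    peerEstimate P s i (Function.update t' i t) w = peerEstimate P s i t' w := by
  refine projectedEstimator_congr P (fun l hl => ?_) _
  -- Agent `i` is never in the group labelled by the negation of her own label.
  have hne : l ≠ i := by
    rintro rfl
    simp at hl
  simp only [Function.update_of_ne hne]

-- The group is itself random, but there are finitely many partitions, so it suffices to fix one at
-- a time.
variable {s} in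
theorem measurable_peerEstimate (hs : ∀ i, Measurable (s i)) :
    Measurable fun p : (Fin n → AgentType d) × Coins d n => peerEstimate P s i p.1 p.2 := by
  have hz : Measurable fun t' : Fin n → AgentType d => fun j => ((t' j).1.1, s j (t' j)) :=
    measurable_pi_lambda _ fun j =>
      Measurable.prodMk (by fun_prop) ((hs j).comp (measurable_pi_apply j))
  have hb : ∀ b : Fin n → Bool, Measurable
      fun q : (Fin n → AgentType d) × (Noise d × (Bool → Noise d)) =>
      projectedEstimator P (Finset.univ.filter fun j => b j = !b i)
        (fun j => ((q.1 j).1.1, s j (q.1 j))) (q.2.2 (!b i)) := fun b =>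
    (measurable_projectedEstimator P (Finset.univ.filter fun j => b j = !b i)).comp
      (f := fun q : (Fin n → AgentType d) × (Noise d × (Bool → Noise d)) =>
        ((fun j => ((q.1 j).1.1, s j (q.1 j))), q.2.2 (!b i)))
      ((hz.comp measurable_fst).prodMk ((measurable_pi_apply _).comp (by fun_prop)))
  have h : Measurable fun p :
      (Fin n → Bool) × ((Fin n → AgentType d) × (Noise d × (Bool → Noise d))) =>
      peerEstimate P s i p.2.1 (p.1, p.2.2) :=
    measurable_from_prod_countable_right hb
  exact h.comp (f := fun p : (Fin n → AgentType d) × Coins d n => (p.2.1, (p.1, p.2.2)))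
    (by fun_prop)

/-- The agent's report enters only the second argument of the score, through the posterior mean. -/
theorem payment_reports (t : AgentType d) (y : ℝ) (t' : Fin n → AgentType d) (w : Coins d n) :
    (mechanism M P a₁ a₂ (reports s i t y t') w).payment i =
      brier a₁ a₂ (inner ℝ (clipBall P.r t.1.1) (peerEstimate P s i t' w))
        (inner ℝ (clipBall P.r t.1.1) (M.posteriorMean (t.1.1, y))) := by
  have h : projectedEstimator P (Finset.univ.filter fun j => w.1 j = !w.1 i)
      (reports s i t y t') (w.2.2 (!w.1 i)) = peerEstimate P s i t' w := by
    refine projectedEstimator_congr P (fun l hl => ?_) _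
    have hne : l ≠ i := by
      rintro rfl
      simp at hl
    simp only [reports, Function.update_of_ne hne]
  simp only [mechanism, h]
  simp [reports]

/-- The expectation of `⟨x_i, θ̄⟩` given the type of agent `i`, where `θ̄` is the peer estimate. -/
noncomputable def peerPrediction (t : AgentType d) : ℝ :=
  ∫ b, inner ℝ t.1.1 (peerEstimate P s i b.1 b.2) ∂((M.beliefs i t).prod (coinLaw d ρ))

variable {P s} in
theorem abs_inner_peerEstimate_le (hτ : 0 ≤ P.τθ) (x : Vec d) (t' : Fin n → AgentType d)
    (w : Coins d n) : |inner ℝ x (peerEstimate P s i t' w)| ≤ ‖x‖ * P.τθ :=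
  (abs_real_inner_le_norm _ _).trans
    (mul_le_mul_of_nonneg_left (norm_peerEstimate_le P s i hτ t' w) (norm_nonneg _))

-- The score is affine in its first argument, so the expectation moves inside. Clipping multiplies
-- `x_i` by a factor that depends on the agent's own type only and comes out too; this leaves the
-- unclipped feature, for which sub-Gaussianity is assumed.
variable {P s} in
theorem interimUtility_eq [IsProbabilityMeasure ρ] (hτ : 0 ≤ P.τθ) (hs : ∀ i, Measurable (s i))
    (t : AgentType d) (y : ℝ) :
    interimUtility M P a₁ a₂ ρ f s i t y =
      brier a₁ a₂ (min 1 (P.r / ‖t.1.1‖) * peerPrediction M P ρ s i t)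
        (inner ℝ (clipBall P.r t.1.1) (M.posteriorMean (t.1.1, y))) -
      f i t.1 y t.2 (2 * P.ε) (3 * P.δ) := by
  have hint : Integrable (fun b : (Fin n → AgentType d) × Coins d n =>
      inner ℝ t.1.1 (peerEstimate P s i b.1 b.2)) ((M.beliefs i t).prod (coinLaw d ρ)) :=
    Integrable.of_bound
      (measurable_const.inner (measurable_peerEstimate P i hs)).aestronglyMeasurable
      (‖t.1.1‖ * P.τθ) (.of_forall fun b => abs_inner_peerEstimate_le i hτ _ _ _)
  set q := inner ℝ (clipBall P.r t.1.1) (M.posteriorMean (t.1.1, y)) with hq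
  set m := min 1 (P.r / ‖t.1.1‖) with hm
  set φ := f i t.1 y t.2 (2 * P.ε) (3 * P.δ) with hφ
  have heq : ∀ t' w, (mechanism M P a₁ a₂ (reports s i t y t') w).payment i - φ =
      (a₁ - a₂ * q ^ 2 - φ) -
        (a₂ * m * (1 - 2 * q)) * inner ℝ t.1.1 (peerEstimate P s i t' w) := by
    intro t' w
    rw [payment_reports, ← hq, clipBall, ← hm, real_inner_smul_left, brier]
    ring
  have hint' := (integrable_const (μ := (M.beliefs i t).prod (coinLaw d ρ))
    (a₁ - a₂ * q ^ 2 - φ)).sub (hint.const_mul (a₂ * m * (1 - 2 * q)))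
  simp only [interimUtility, ← hφ, heq]
  rw [← integral_prod (fun b : (Fin n → AgentType d) × Coins d n => (a₁ - a₂ * q ^ 2 - φ) -
        (a₂ * m * (1 - 2 * q)) * inner ℝ t.1.1 (peerEstimate P s i b.1 b.2)) hint',
    integral_sub (integrable_const _) (hint.const_mul _), integral_const_mul]
  simp only [integral_const, probReal_univ, one_smul, brier, peerPrediction]
  ring

/-- A deviation from the truth increases the expected payment by at most a multiple of the squared
distance between the peer prediction and the prediction by the posterior mean. -/
theorem interimUtility_sub_le [IsProbabilityMeasure ρ] {P : Params} {s : Fin n → Strategy d}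
    (hτ : 0 ≤ P.τθ) (hs : ∀ i, Measurable (s i)) (hr : 0 ≤ P.r) {a₂ : ℝ} (ha₂ : 0 ≤ a₂)
    (t : AgentType d) (y : ℝ) {B : ℝ} (hpeer : |peerPrediction M P ρ s i t| ≤ B)
    (hpost : |inner ℝ t.1.1 (M.posteriorMean t.1)| ≤ B) :
    interimUtility M P a₁ a₂ ρ f s i t y - interimUtility M P a₁ a₂ ρ f s i t t.1.2 ≤
      4 * a₂ * B ^ 2 + (f i t.1 t.1.2 t.2 (2 * P.ε) (3 * P.δ) -
        f i t.1 y t.2 (2 * P.ε) (3 * P.δ)) := by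
  rw [interimUtility_eq M a₁ a₂ ρ f i hτ hs, interimUtility_eq M a₁ a₂ ρ f i hτ hs]
  set q' := inner ℝ (clipBall P.r t.1.1) (M.posteriorMean (t.1.1, y))
  set m := min 1 (P.r / ‖t.1.1‖) with hm
  have hm0 : 0 ≤ m := by positivity
  have hm1 : m ≤ 1 := min_le_left _ _
  rw [clipBall, ← hm, real_inner_smul_left, Prod.mk.eta]
  set q := inner ℝ t.1.1 (M.posteriorMean t.1)
  set p := peerPrediction M P ρ s i t
  have hd : (m * (q - p)) ^ 2 ≤ 4 * B ^ 2 := by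
    have h : |m * (q - p)| ≤ 2 * B := by
      rw [abs_mul, abs_of_nonneg hm0]
      calc m * |q - p| ≤ 1 * |q - p| := by gcongr
        _ ≤ |q| + |p| := by rw [one_mul]; exact abs_sub _ _
        _ ≤ 2 * B := by linarith
    calc (m * (q - p)) ^ 2 ≤ (2 * B) ^ 2 := sq_le_sq' (abs_le.1 h).1 (abs_le.1 h).2
      _ = 4 * B ^ 2 := by ring
  -- Completing the square: the gain in payment is `a₂ ((m q - m p)² - (q' - m p)²)`, and the second
  -- square is dropped.
  simp only [brier]
  nlinarith [mul_le_mul_of_nonneg_left hd ha₂, mul_nonneg ha₂ (sq_nonneg (q' - m * p))]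

end Payments

/-! ### Laws of the types -/

section Laws

variable {d : ℕ} (M : RegressionModel d)

theorem map_eval_piKernel {A B : Type*} [MeasurableSpace A] [MeasurableSpace B] {n : ℕ}
    (κ : Kernel A B) [IsMarkovKernel κ] (i : Fin n) :
    (piKernel n κ).map (fun t => t i) = κ := by
  ext1 a
  rw [Kernel.map_apply _ (measurable_pi_apply i)]
  exact (measurePreserving_eval (fun _ : Fin n => κ a) i).map_eq

theorem jointLaw_map_eval {n : ℕ} (i : Fin n) :
    (M.jointLaw n).map (fun t => t i) = M.prior.bind M.agentLaw := by
  rw [RegressionModel.jointLaw, Measure.map_comp _ _ (measurable_pi_apply i), map_eval_piKernel]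

theorem agentLaw_map_fst (θ : Vec d) : (M.agentLaw θ).map Prod.fst = M.data θ := by
  have h := Kernel.fst_compProd M.data (Kernel.prodMkLeft (Vec d) M.cost)
  rw [RegressionModel.agentLaw, ← Kernel.fst_apply, h]

theorem jointLaw_map_datum {n : ℕ} (i : Fin n) :
    (M.jointLaw n).map (fun t => (t i).1) = M.prior.bind M.data := by
  have h : M.agentLaw.map Prod.fst = M.data := by
    ext1 θ
    rw [Kernel.map_apply _ measurable_fst, agentLaw_map_fst]
  rw [show (fun t : Fin n → AgentType d => (t i).1) = Prod.fst ∘ fun t => t i from rfl,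
    ← Measure.map_map measurable_fst (measurable_pi_apply i), jointLaw_map_eval,
    Measure.map_comp _ _ measurable_fst, h]

variable {M} {σ : ℝ≥0} {τθ rate : ℝ} {k : ℕ}

/-- Exponential moments of `⟨x, v⟩` under the law of the data. -/
theorem RegressionModel.Satisfies.lintegral_exp_inner_le (hM : M.Satisfies σ τθ k rate) :
    ∀ᵐ θ ∂M.prior, ∀ (v : Vec d), ‖v‖ ≤ τθ → ∀ l : ℝ,
      ∫⁻ D, ENNReal.ofReal (Real.exp (l * inner ℝ D.1 v)) ∂M.data θ ≤
        ENNReal.ofReal (Real.exp (σ ^ 2 / d * τθ ^ 2 * l ^ 2 / 2)) := by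
  obtain ⟨PX, hPX, hsub⟩ := hM.covariates
  filter_upwards [hPX] with θ hθ v hv l
  have : IsProbabilityMeasure PX := hθ ▸ Measure.isProbabilityMeasure_map (by fun_prop)
  have h := TruthfulRegression.lintegral_exp_inner_le hsub hv l
  rw [← hθ, lintegral_map (by fun_prop) measurable_fst] at h
  simpa using h

theorem RegressionModel.Satisfies.ae_cost_nonneg (hM : M.Satisfies σ τθ k rate) {n : ℕ}
    (i : Fin n) : ∀ᵐ t ∂M.jointLaw n, 0 ≤ (t i).2 := by
  have hmeas : MeasurableSet {t : AgentType d | 0 ≤ t.2} :=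
    measurableSet_le measurable_const measurable_snd
  suffices h : ∀ᵐ t ∂(M.jointLaw n).map (fun t => t i), 0 ≤ t.2 from
    ae_of_ae_map (measurable_pi_apply i).aemeasurable h
  rw [jointLaw_map_eval]
  rw [ae_iff, show {a : AgentType d | ¬ 0 ≤ a.2} = {t : AgentType d | 0 ≤ t.2}ᶜ from rfl,
    Measure.bind_apply hmeas.compl M.agentLaw.measurable.aemeasurable]
  refine (lintegral_congr fun θ => ?_).trans lintegral_zero
  have h : ∀ᵐ t ∂M.agentLaw θ, 0 ≤ t.2 :=
    (Kernel.ae_compProd_iff hmeas).2 (.of_forall fun D => hM.cost_nonneg D)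
  exact ae_iff.1 h

/-- Tail bound for the prediction by the posterior mean. -/
theorem RegressionModel.Satisfies.measure_posteriorMean_le (hM : M.Satisfies σ τθ k rate) {n : ℕ}
    (i : Fin n) (hσ : 0 < σ) (hτ : 0 < τθ) (hd : 0 < d) {B : ℝ} (hB : 0 ≤ B) :
    M.jointLaw n {t | B < |inner ℝ (t i).1.1 (M.posteriorMean (t i).1)|} ≤
      2 * ENNReal.ofReal (Real.exp (-(B ^ 2 / (2 * (σ ^ 2 / d * τθ ^ 2))))) := by
  -- Averaging the posterior over the data gives back the prior, so almost every posterior inherits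
  -- the norm bound.
  have hae : ∀ᵐ D ∂(M.prior.bind M.data), ∀ᵐ θ ∂posterior M.data M.prior D, ‖θ‖ ≤ τθ := by
    refine Measure.ae_ae_of_ae_bind (posterior M.data M.prior).measurable.aemeasurable ?_
    rw [posterior_comp_self]
    exact hM.norm_le
  have hmeas : Measurable fun p : Datum d × Vec d => (inner ℝ p.1.1 p.2 : ℝ) := by fun_prop
  have key := measure_lt_abs_integral_le_exp (M.prior.bind M.data) (posterior M.data M.prior)
    (F := fun D θ => inner ℝ D.1 θ) hmeas
    (by
      filter_upwards [hae] with D hD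
      refine ⟨‖D.1‖ * τθ, ?_⟩
      filter_upwards [hD] with θ hθ
      exact (abs_real_inner_le_norm _ _).trans (by gcongr))
    (v := σ ^ 2 / d * τθ ^ 2) (by positivity)
    (fun l => by
      -- Bayes' rule reverses the order of sampling: `θ` first, then the data given `θ`, so that the
      -- sub-Gaussian bound applies with `θ` fixed.
      rw [← Measure.lintegral_compProd
          (f := fun p : Datum d × Vec d => ENNReal.ofReal (Real.exp (l * inner ℝ p.1.1 p.2)))
          (by fun_prop), compProd_posterior_eq_map_swap,
        lintegral_map (by fun_prop) measurable_swap]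
      rw [Measure.lintegral_compProd (by fun_prop)]
      calc _ ≤ ∫⁻ _, ENNReal.ofReal (Real.exp (σ ^ 2 / d * τθ ^ 2 * l ^ 2 / 2)) ∂M.prior := by
            refine lintegral_mono_ae ?_
            filter_upwards [hM.lintegral_exp_inner_le, hM.norm_le] with θ hθ hn
            exact hθ θ hn l
        _ = _ := by simp) hB
  rw [← jointLaw_map_datum M i] at key
  have hm : AEMeasurable (fun t : Fin n → AgentType d => (t i).1) (M.jointLaw n) :=
    Measurable.aemeasurable (by fun_prop)
  -- This inequality holds for arbitrary sets, so the event need not be shown measurable.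
  refine (le_trans ?_ (Measure.le_map_apply hm _)).trans key
  refine measure_mono_ae ?_
  have hae' := hae
  rw [← jointLaw_map_datum M i] at hae'
  filter_upwards [ae_of_ae_map hm hae'] with t ht hBt
  change B < |∫ θ, inner ℝ (t i).1.1 θ ∂posterior M.data M.prior (t i).1|
  rw [integral_inner]
  · exact hBt
  · exact Integrable.of_bound (by fun_prop) τθ ht

/-- Tail bound for the peer prediction. -/
theorem RegressionModel.Satisfies.measure_peerPrediction_le (hM : M.Satisfies σ τθ k rate) {n : ℕ}
    (i : Fin n) (hσ : 0 < σ) (hτ : 0 < τθ) (hd : 0 < d) {P : Params} (hP : P.τθ = τθ)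
    {s : Fin n → Strategy d} (hs : ∀ i, Measurable (s i)) (ρ : Measure (Fin n → Bool))
    [IsProbabilityMeasure ρ] {B : ℝ} (hB : 0 ≤ B) :
    M.jointLaw n {t | B < |peerPrediction M P ρ s i (t i)|} ≤
      2 * ENNReal.ofReal (Real.exp (-(B ^ 2 / (2 * (σ ^ 2 / d * τθ ^ 2))))) := by
  have hpeer := measurable_peerEstimate P i hs
  have hPτ : 0 ≤ P.τθ := hP ▸ hτ.le
  have key := measure_lt_abs_integral_le_exp ((M.jointLaw n).map fun t => t i)
    (M.beliefs i ×ₖ Kernel.const _ (coinLaw d ρ))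
    (F := fun t b => inner ℝ t.1.1 (peerEstimate P s i b.1 b.2))
    (Measurable.inner (by fun_prop) (hpeer.comp measurable_snd))
    (.of_forall fun t => ⟨_, .of_forall fun b => abs_inner_peerEstimate_le i hPτ _ _ _⟩)
    (v := σ ^ 2 / d * τθ ^ 2) (by positivity)
    (fun l => by
      set G : AgentType d → (Fin n → AgentType d) → Coins d n → ℝ≥0∞ := fun t t' w =>
        ENNReal.ofReal (Real.exp (l * inner ℝ t.1.1 (peerEstimate P s i t' w))) with hG
      have hGm : Measurable fun p : (AgentType d × (Fin n → AgentType d)) × Coins d n =>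
          G p.1.1 p.1.2 p.2 := by
        have h₁ : Measurable fun p : (AgentType d × (Fin n → AgentType d)) × Coins d n =>
            peerEstimate P s i p.1.2 p.2 :=
          hpeer.comp (f := fun p : (AgentType d × (Fin n → AgentType d)) × Coins d n =>
            (p.1.2, p.2)) (by fun_prop)
        have h₂ : Measurable fun p : (AgentType d × (Fin n → AgentType d)) × Coins d n =>
            (inner ℝ p.1.1.1.1 (peerEstimate P s i p.1.2 p.2) : ℝ) :=
          Measurable.inner (by fun_prop) h₁
        exact ENNReal.measurable_ofReal.comp (Real.measurable_exp.comp (h₂.const_mul l))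
      have hGt : ∀ t, Measurable fun b : (Fin n → AgentType d) × Coins d n => G t b.1 b.2 :=
        fun t => hGm.comp (f := fun b : (Fin n → AgentType d) × Coins d n => ((t, b.1), b.2))
          (by fun_prop)
      have hH : Measurable fun p : AgentType d × (Fin n → AgentType d) =>
          ∫⁻ w, G p.1 p.2 w ∂coinLaw d ρ := hGm.lintegral_prod_right'
      calc ∫⁻ t, ∫⁻ b, G t b.1 b.2 ∂(M.beliefs i ×ₖ Kernel.const _ (coinLaw d ρ)) t
              ∂(M.jointLaw n).map (fun t => t i)
          = ∫⁻ t, ∫⁻ t', ∫⁻ w, G t t' w ∂coinLaw d ρ ∂M.beliefs i t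
              ∂(M.jointLaw n).map (fun t => t i) := by
            refine lintegral_congr fun t => ?_
            rw [Kernel.prod_apply, Kernel.const_apply, lintegral_prod _ (hGt t).aemeasurable]
        -- Averaging the beliefs over the agent's own type restores the joint law.
        _ = ∫⁻ t', ∫⁻ w, G (t' i) t' w ∂coinLaw d ρ ∂M.jointLaw n := by
            rw [← Measure.lintegral_compProd
                (f := fun p : AgentType d × (Fin n → AgentType d) =>
                  ∫⁻ w, G p.1 p.2 w ∂coinLaw d ρ) hH, RegressionModel.beliefs,
              compProd_map_condDistrib (by fun_prop), lintegral_map hH (by fun_prop)]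
        _ = ∫⁻ θ, ∫⁻ t', ∫⁻ w, G (t' i) t' w ∂coinLaw d ρ ∂(piKernel n M.agentLaw) θ
              ∂M.prior := by
            rw [RegressionModel.jointLaw, Measure.lintegral_bind
              (piKernel n M.agentLaw).measurable.aemeasurable]
            exact (hH.comp (f := fun t' : Fin n → AgentType d => (t' i, t'))
              (by fun_prop)).aemeasurable
        _ ≤ ∫⁻ _, ENNReal.ofReal (Real.exp (σ ^ 2 / d * τθ ^ 2 * l ^ 2 / 2)) ∂M.prior := by
            refine lintegral_mono_ae ?_
            filter_upwards [hM.lintegral_exp_inner_le] with θ hθ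
            -- Given `θ` the agents are independent: the other types are frozen and, after the swap
            -- below, the coins too. By `peerEstimate_update` the estimate is then a fixed vector
            -- while the type of agent `i` is averaged.
            refine lintegral_pi_le_of_forall_update (fun _ : Fin n => M.agentLaw θ)
              (hH.comp (f := fun t' : Fin n → AgentType d => (t' i, t')) (by fun_prop)) i
              fun x => ?_
            have hswap : ∫⁻ t, ∫⁻ w, G t x w ∂coinLaw d ρ ∂M.agentLaw θ ≤
                ENNReal.ofReal (Real.exp (σ ^ 2 / d * τθ ^ 2 * l ^ 2 / 2)) := by
              rw [lintegral_lintegral_swap]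
              · calc _ ≤ ∫⁻ _, ENNReal.ofReal (Real.exp (σ ^ 2 / d * τθ ^ 2 * l ^ 2 / 2))
                      ∂coinLaw d ρ := by
                      refine lintegral_mono fun w => ?_
                      have h := hθ (peerEstimate P s i x w)
                        (hP ▸ norm_peerEstimate_le P s i hPτ x w) l
                      rwa [← agentLaw_map_fst, lintegral_map (by fun_prop) measurable_fst] at h
                  _ = _ := by simp
              · exact (hGm.comp (f := fun q : AgentType d × Coins d n => ((q.1, x), q.2))
                  (by fun_prop)).aemeasurable
            simpa [hG, peerEstimate_update] using hswap
        _ = _ := by simp) hB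
  refine (Measure.le_map_apply (μ := M.jointLaw n) (f := fun t : Fin n → AgentType d => t i)
    (measurable_pi_apply i).aemeasurable {t | B < |peerPrediction M P ρ s i t|}).trans ?_
  simpa [peerPrediction, Kernel.prod_apply] using key

end Laws

/-! ### The equilibrium -/

/-- The level that predictions exceed with polynomially small probability. -/
noncomputable def predictionLevel (σ : ℝ≥0) (τθ : ℝ) (d : ℕ) : ℝ :=
  √(14 * (σ ^ 2 / d * τθ ^ 2) * Real.log d)

theorem predictionLevel_sq (σ : ℝ≥0) (τθ : ℝ) (d : ℕ) :
    predictionLevel σ τθ d ^ 2 = 14 * (σ ^ 2 / d * τθ ^ 2) * Real.log d :=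
  Real.sq_sqrt (mul_nonneg (by positivity) (Real.log_natCast_nonneg d))

/-- The factor 14 makes the exponential equal to `d ^ (-7)`. The 4 adds up two two-sided tails and
is absorbed by `d ^ (5/2)`, as `d ≥ 2`. -/
theorem exp_predictionLevel_le {σ : ℝ≥0} {τθ : ℝ} {d : ℕ} (hσ : 0 < σ) (hτ : 0 < τθ)
    (hd : 2 ≤ d) :
    4 * Real.exp (-(predictionLevel σ τθ d ^ 2 / (2 * (σ ^ 2 / d * τθ ^ 2)))) ≤
      (d : ℝ) ^ (-(9 / 2) : ℝ) := by
  have hd0 : (0 : ℝ) < d := by positivity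
  have hd2 : (2 : ℝ) ≤ d := by exact_mod_cast hd
  have hσ' : (0 : ℝ) < σ := hσ
  have h : -(predictionLevel σ τθ d ^ 2 / (2 * (σ ^ 2 / d * τθ ^ 2))) = Real.log d * (-7) := by
    rw [predictionLevel_sq]
    field_simp
    ring
  rw [h, ← Real.rpow_def_of_pos hd0]
  have h4 : (4 : ℝ) ≤ (d : ℝ) ^ (5 / 2 : ℝ) := by
    calc (4 : ℝ) = 2 ^ (2 : ℝ) := by norm_num
      _ ≤ (d : ℝ) ^ (2 : ℝ) := by gcongr
      _ ≤ (d : ℝ) ^ (5 / 2 : ℝ) :=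
        Real.rpow_le_rpow_of_exponent_le (by linarith) (by norm_num)
  calc 4 * (d : ℝ) ^ (-7 : ℝ) ≤ (d : ℝ) ^ (5 / 2 : ℝ) * (d : ℝ) ^ (-7 : ℝ) := by gcongr
    _ = (d : ℝ) ^ (-(9 / 2) : ℝ) := by
      rw [← Real.rpow_add hd0]
      norm_num

/-- The threshold strategy is an approximate equilibrium up to the prediction error and the
variation of the privacy costs, except with probability `n d ^ (-9 / 2)`. -/
theorem RegressionModel.Satisfies.measure_not_isApproxBNEAt_le {d n k : ℕ}
    {M : RegressionModel d} {σ : ℝ≥0} {τθ rate : ℝ} (hM : M.Satisfies σ τθ k rate) (hσ : 0 < σ)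
    (hτ : 0 < τθ) (hd : 2 ≤ d) {P : Params} (hP : P.τθ = τθ) (hr : 0 ≤ P.r) (a₁ : ℝ) {a₂ : ℝ}
    (ha₂ : 0 ≤ a₂) (ρ : Measure (Fin n → Bool)) [IsProbabilityMeasure ρ] (f : PrivacyCost d n)
    {s : Fin n → Strategy d} (hs : ∀ i, Measurable (s i)) {T η : ℝ}
    (hall : ∀ i t, s i t ∈ thresholdReports T t)
    (hgain : ∀ i (t : AgentType d) y, 0 ≤ t.2 → t.2 ≤ T →
      4 * a₂ * predictionLevel σ τθ d ^ 2 + (f i t.1 t.1.2 t.2 (2 * P.ε) (3 * P.δ) -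
        f i t.1 y t.2 (2 * P.ε) (3 * P.δ)) ≤ η) :
    M.jointLaw n {t | ¬ IsApproxBNEAt M P a₁ a₂ ρ f s (thresholdReports T) η t} ≤
      ENNReal.ofReal (n * (d : ℝ) ^ (-(9 / 2) : ℝ)) := by
  set B := predictionLevel σ τθ d with hB
  have hB0 : 0 ≤ B := Real.sqrt_nonneg _
  have hd0 : 0 < d := by omega
  have hsub : {t | ¬ IsApproxBNEAt M P a₁ a₂ ρ f s (thresholdReports T) η t} ⊆
      ⋃ i, ({t : Fin n → AgentType d | ¬ 0 ≤ (t i).2} ∪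
        ({t | B < |inner ℝ (t i).1.1 (M.posteriorMean (t i).1)|} ∪
          {t | B < |peerPrediction M P ρ s i (t i)|})) := by
    intro t ht
    by_contra hcon
    simp only [Set.mem_iUnion, Set.mem_union, Set.mem_ofPred_eq, not_exists, not_or, not_not,
      not_lt] at hcon
    refine ht fun i y hy => ?_
    obtain ⟨hc, hpost, hpeer⟩ := hcon i
    -- Above the threshold every report is allowed, so a forbidden report forces a low cost, and
    -- then the strategy is truthful.
    have hcT : (t i).2 ≤ T := by
      by_contra hlt
      exact hy fun h => absurd h hlt
    rw [hall i (t i) hcT]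
    have h₁ := interimUtility_sub_le M a₁ ρ f i (hP ▸ hτ.le) hs hr ha₂ (t i) y hpeer hpost
    linarith [hgain i (t i) y hc hcT]
  have hi : ∀ i : Fin n, M.jointLaw n ({t : Fin n → AgentType d | ¬ 0 ≤ (t i).2} ∪
        ({t | B < |inner ℝ (t i).1.1 (M.posteriorMean (t i).1)|} ∪
          {t | B < |peerPrediction M P ρ s i (t i)|})) ≤
      ENNReal.ofReal ((d : ℝ) ^ (-(9 / 2) : ℝ)) := by
    intro i
    have h₂ := hM.measure_posteriorMean_le i hσ hτ hd0 hB0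
    have h₃ := hM.measure_peerPrediction_le i hσ hτ hd0 hP hs ρ hB0
    refine (measure_union_le _ _).trans ?_
    rw [ae_iff.1 (hM.ae_cost_nonneg i), zero_add]
    refine (measure_union_le _ _).trans ((add_le_add h₂ h₃).trans ?_)
    refine le_trans (le_of_eq ?_) (ENNReal.ofReal_le_ofReal (exp_predictionLevel_le hσ hτ hd))
    rw [ENNReal.ofReal_mul (by norm_num), ← add_mul, ← hB]
    norm_num
  calc _ ≤ ∑ i : Fin n, ENNReal.ofReal ((d : ℝ) ^ (-(9 / 2) : ℝ)) :=
        (measure_mono hsub).trans ((measure_iUnion_fintype_le _ _).trans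
          (Finset.sum_le_sum fun i _ => hi i))
    _ = ENNReal.ofReal (n * (d : ℝ) ^ (-(9 / 2) : ℝ)) := by
        rw [Finset.sum_const, Finset.card_univ, Fintype.card_fin, nsmul_eq_mul,
          ENNReal.ofReal_mul (by positivity), ENNReal.ofReal_natCast]

/-- The squared level is a multiple of `log d / d`, and `1 / d ≤ 1 / (n ε²)`. The factors `r⁴` and
`log (1/δ)` are bounded below by constants since `n ≥ 2` and `δ ≤ 1/2`; these give `log 2 ^ 3` in
the denominator, and `56 = 4 * 14`. -/
theorem predictionError_le_paymentGap {σ : ℝ≥0} (hσ : 0 < σ) {τθ c₁ : ℝ} (hc₁ : 0 < c₁)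
    {n d k : ℕ} (hn : 2 ≤ n) (hnd : n ≤ d) {P : Params} (hr : c₁ * (σ * √(Real.log n)) ≤ P.r)
    (hε : 0 < P.ε) (hε1 : P.ε ≤ 1) (hδ : 0 < P.δ) (hδ2 : P.δ ≤ 1 / 2) {a₂ : ℝ} (ha₂ : 0 < a₂)
    (α : ℝ) :
    4 * a₂ * predictionLevel σ τθ d ^ 2 ≤
      56 * τθ ^ 2 / (c₁ ^ 4 * σ ^ 2 * Real.log 2 ^ 3) * paymentGap P a₂ α n d k := by
  have hσ' : (0 : ℝ) < σ := hσ
  have hn2 : (2 : ℝ) ≤ n := by exact_mod_cast hn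
  have hnd' : (n : ℝ) ≤ d := by exact_mod_cast hnd
  have hn0 : (0 : ℝ) < n := by linarith
  have hd0 : (0 : ℝ) < d := by linarith
  have hl2 : 0 < Real.log 2 := Real.log_pos (by norm_num)
  have hlogn : Real.log 2 ≤ Real.log n := Real.log_le_log (by norm_num) hn2
  have hlogd : 0 < Real.log d := Real.log_pos (by linarith)
  have hlogδ : Real.log 2 ≤ Real.log (1 / P.δ) := by
    refine Real.log_le_log (by norm_num) ?_
    rw [le_div_iff₀ hδ]
    linarith
  have hr4 : c₁ ^ 4 * σ ^ 4 * Real.log 2 ^ 2 ≤ P.r ^ 4 := by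
    calc c₁ ^ 4 * σ ^ 4 * Real.log 2 ^ 2 = (c₁ * (σ * √(Real.log 2))) ^ 4 := by
          have : √(Real.log 2) ^ 4 = Real.log 2 ^ 2 := by
            rw [show √(Real.log 2) ^ 4 = (√(Real.log 2) ^ 2) ^ 2 by ring, Real.sq_sqrt hl2.le]
          rw [mul_pow, mul_pow, this]
          ring
      _ ≤ (c₁ * (σ * √(Real.log n))) ^ 4 := by gcongr
      _ ≤ P.r ^ 4 := by gcongr
  have hgap : 1 / (d : ℝ) ≤ n * α ^ 2 * k / P.ε ^ 2 + 1 / (n * P.ε ^ 2) := by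
    have h₁ : (n : ℝ) * P.ε ^ 2 ≤ (d : ℝ) := by
      calc (n : ℝ) * P.ε ^ 2 ≤ (d : ℝ) * 1 ^ 2 := by gcongr
        _ = (d : ℝ) := by ring
    have h₂ : 1 / (d : ℝ) ≤ 1 / (n * P.ε ^ 2) := by gcongr
    have h₃ : 0 ≤ n * α ^ 2 * k / P.ε ^ 2 := by positivity
    linarith
  have hlogδ0 : 0 < Real.log (1 / P.δ) := hl2.trans_le hlogδ
  calc 4 * a₂ * predictionLevel σ τθ d ^ 2
      = 56 * τθ ^ 2 / (c₁ ^ 4 * σ ^ 2 * Real.log 2 ^ 3) *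
          (a₂ * (c₁ ^ 4 * σ ^ 4 * Real.log 2 ^ 2) * Real.log d * Real.log 2 * (1 / d)) := by
        rw [predictionLevel_sq]
        field_simp
        ring
    _ ≤ 56 * τθ ^ 2 / (c₁ ^ 4 * σ ^ 2 * Real.log 2 ^ 3) * paymentGap P a₂ α n d k := by
        unfold paymentGap
        gcongr

/-- The second cost is at least zero, and at the level `(2ε, 3δ)` the first is at most `8 (1 + 3δ) c
ε³`, where `1 + 3δ ≤ 3 (1 + δ)`. -/
theorem PrivacyCost.Bounded.sub_le {d n : ℕ} {f : PrivacyCost d n} (hf : f.Bounded) (i : Fin n)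
    (D : Datum d) (y y' : ℝ) {c T ε δ : ℝ} (hc : 0 ≤ c) (hcT : c ≤ T) (hε : 0 < ε) (hδ : 0 < δ) :
    f i D y c (2 * ε) (3 * δ) - f i D y' c (2 * ε) (3 * δ) ≤ 24 * (T * (1 + δ) * ε ^ 3) := by
  have h₁ := (hf i D y c (2 * ε) (3 * δ) hc (by positivity) (by positivity)).2
  have h₂ := (hf i D y' c (2 * ε) (3 * δ) hc (by positivity) (by positivity)).1
  have h₃ : c * (1 + 3 * δ) * (2 * ε) ^ 3 ≤ 24 * (T * (1 + δ) * ε ^ 3) := by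
    calc c * (1 + 3 * δ) * (2 * ε) ^ 3 ≤ T * (3 * (1 + δ)) * (2 * ε) ^ 3 := by
          have hδ3 : 1 + 3 * δ ≤ 3 * (1 + δ) := by linarith
          have hT : 0 ≤ T := hc.trans hcT
          gcongr
      _ = 24 * (T * (1 + δ) * ε ^ 3) := by ring
  linarith

end TruthfulRegression

theorem mainTheorem4 (σ : ℝ≥0) (hσ : 0 < σ) (τθ : ℝ) (hτθ : 0 < τθ)
    (c₁ c₂ : ℝ) (hc₁ : 0 < c₁) (hc₂ : c₁ ≤ c₂) :
    ∃ C c : ℝ, 0 < C ∧ 0 < c ∧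
      ∀ (n d k : ℕ), 2 ≤ n → n ≤ d →
      ∀ (M : RegressionModel d) (rate : ℝ), 0 < rate → M.Satisfies σ τθ k rate →
      ∀ P : Params, P.τθ = τθ →
        c₁ * (σ * √(Real.log n)) ≤ P.r → P.r ≤ c₂ * (σ * √(Real.log n)) →
        0 < P.τx → 0 < P.τy → 0 < P.lam → 0 < P.γ →
        0 < P.ε → P.ε ≤ 1 → 0 < P.δ → P.δ ≤ 1 / 2 →
      ∀ a₁ a₂ : ℝ, 0 < a₁ → 0 < a₂ →
      ∀ α β : ℝ, 0 < α → α < 1 → 0 < β → β < 1 →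
      ∀ (ρ : Measure (Fin n → Bool)), IsProbabilityMeasure ρ →
      ∀ f : PrivacyCost d n, f.Bounded →
      ∀ s : Fin n → Strategy d, (∀ i, Measurable (s i)) →
        (∀ i t, s i t ∈ thresholdReports (M.threshold n α β) t) →
      M.jointLaw n {t | ¬ IsApproxBNEAt M P a₁ a₂ ρ f s
          (thresholdReports (M.threshold n α β))
          (C * (paymentGap P a₂ α n d k + M.threshold n α β * (1 + P.δ) * P.ε ^ 3)) t} ≤
        ENNReal.ofReal (β + C * (n : ℝ) ^ (-c) + n * (d : ℝ) ^ (-(9 / 2) : ℝ)) ∧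
      (f.ReportIndependent →
        M.jointLaw n {t | ¬ IsApproxBNEAt M P a₁ a₂ ρ f s
            (thresholdReports (M.threshold n α β))
            (C * (paymentGap P a₂ α n d k + M.threshold n α β * P.δ * P.ε ^ 3)) t} ≤
          ENNReal.ofReal (β + C * (n : ℝ) ^ (-c) + n * (d : ℝ) ^ (-(9 / 2) : ℝ))) := by
  have hσ' : (0 : ℝ) < σ := hσ
  have hl2 : 0 < Real.log 2 := Real.log_pos (by norm_num)
  set C₀ := 56 * τθ ^ 2 / (c₁ ^ 4 * σ ^ 2 * Real.log 2 ^ 3) with hC₀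
  have hC₀pos : 0 < C₀ := by positivity
  -- `C₀` pays for the prediction error and 24 for the privacy costs. The exponent 1 is an arbitrary
  -- choice: the `n d ^ (-9/2)` term alone carries the failure probability.
  refine ⟨C₀ + 24, 1, by positivity, one_pos, ?_⟩
  intro n d k hn hnd M rate _ hM P hP hr _ _ _ _ _ hε hε1 hδ hδ2 a₁ a₂ _ ha₂ α β _ _ hβ _ ρ _ f hf
    s hs hall
  have hr0 : 0 ≤ P.r := le_trans (by positivity) hr
  have hpay := predictionError_le_paymentGap (τθ := τθ) (k := k) hσ hc₁ hn hnd hr hε hε1 hδ hδ2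
    ha₂ α
  rw [← hC₀] at hpay
  have hgap : 0 ≤ paymentGap P a₂ α n d k :=
    nonneg_of_mul_nonneg_right (le_trans (by positivity) hpay) hC₀pos
  have hbound : ENNReal.ofReal (n * (d : ℝ) ^ (-(9 / 2) : ℝ)) ≤
      ENNReal.ofReal (β + (C₀ + 24) * (n : ℝ) ^ (-1 : ℝ) + n * (d : ℝ) ^ (-(9 / 2) : ℝ)) := by
    refine ENNReal.ofReal_le_ofReal (le_add_of_nonneg_left ?_)
    positivity
  have main := fun η => hM.measure_not_isApproxBNEAt_le hσ hτθ (hn.trans hnd) hP hr0 a₁ ha₂.le ρ f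
    hs (η := η) hall
  refine ⟨(main _ fun i t y hc hcT => ?_).trans hbound,
    fun hind => (main _ fun i t y hc hcT => ?_).trans hbound⟩
  · have h₁ := hf.sub_le i t.1 t.1.2 y hc hcT hε hδ
    -- The constant multiplies both summands of the gap, so the surplus must be nonnegative; the
    -- sign of the threshold is read off from `0 ≤ c ≤ τ`.
    have h₂ : 0 ≤ C₀ * (M.threshold n α β * (1 + P.δ) * P.ε ^ 3) := by
      have := hc.trans hcT
      positivity
    nlinarith
  · rw [hind i t.1 t.1 t.1.2 y, sub_self, add_zero]
    have h₂ : 0 ≤ (C₀ + 24) * (M.threshold n α β * P.δ * P.ε ^ 3) := by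
      have := hc.trans hcT
      positivity
    nlinarith
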